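/- Let $n \ge 2$ and let $S^{n-1} = \{x \in \mathbb{R}^n : x\cdot x = 1\}$. For a finite nonempty set $V$ and a nonnegative matrix $A \in \mathbb{R}^{V\times V}$ write $$\mathrm{sdp}_m(A) = \max\Bigl\{\sum_{x,y\in V} A(x,y)\,(1 - f(x)\cdot f(y)) : f\colon V \to S^{m-1}\Bigr\},$$ let $\gamma_n = \sup \mathrm{sdp}_n(A)/\mathrm{sdp}_1(A)$, the supremum being over all nonnegative matrices $A$ (on finite nonempty index sets) with $\mathrm{sdp}_1(A) \ne 0$, and let $\alpha_n = \gamma_n^{-1}$. Let $$\alpha_{\mathrm{GW}} = \min_{t\in[-1,1)} \frac{1 - (2/\pi)\arcsin t}{1-t},$$ and let $t_{\mathrm{GW}} \in [-1,1)$ be a point where this minimum is attained. For a finite nonempty set $U$ let $\mathrm{CUT}(U)$ be the convex hull of the matrices $(f(x)f(y))_{x,y\in U}$ with $f\colon U\to\{-1,1\}$, and let $\mathrm{CUT}(S^{n-1})$ be the set of continuous functions $K\colon S^{n-1}\times S^{n-1}\to\mathbb{R}$ such that $(K(x,y))_{x,y\in U}\in\mathrm{CUT}(U)$ for every finite nonempty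 $U\subseteq S^{n-1}$. A function $K\colon S^{n-1}\times S^{n-1}\to\mathbb{R}$ is invariant if $K(Tx,Ty) = K(x,y)$ for all $T$ in the orthogonal group $\mathrm{O}(n)$ and all $x,y\in S^{n-1}$; then $K(t)$, for $t \in [-1,1]$, denotes the common value of $K$ on the pairs $(x,y)$ with $x\cdot y = t$. Then $\alpha_n > \alpha_{\mathrm{GW}}$ if and only if there is an invariant $K\in\mathrm{CUT}(S^{n-1})$ such that $$1 - K(t_{\mathrm{GW}}) > 1 - \tfrac{2}{\pi}\arcsin t_{\mathrm{GW}}. \qquad (*)$$ Moreover, if $\alpha_n > \alpha_{\mathrm{GW}}$, then there is a measurable function $f\colon S^{n-1}\to\{-1,1\}$ such that the kernel $$K(x,y) = R(f\otimes f^*)(x,y) = \int_{\mathrm{O}(n)} f(Tx) f(Ty)\,d\mu(T),$$ where $\mu$ is the Haar measure on $\mathrm{O}(n)$ with total measure $1$, is invariant, belongs to $\mathrm{CUT}(S^{n-1})$, and satisfies $(*)$. -/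

import Mathlib

open Set MeasureTheory

noncomputable section

namespace MaxCut

/-- The unit sphere `S^{n-1}` of `ℝⁿ` with the Euclidean norm. -/
abbrev Sphere (n : ℕ) : Type := Metric.sphere (0 : EuclideanSpace ℝ (Fin n)) 1

/-- The Euclidean inner product `x · y` of two points of the sphere. -/
def dot {n : ℕ} (x y : Sphere n) : ℝ :=
  inner ℝ (x : EuclideanSpace ℝ (Fin n)) (y : EuclideanSpace ℝ (Fin n))

/-! ### The rank-constrained semidefinite program and the integrality gap -/

/-- The objective `∑_{x,y} A(x,y) (1 - f(x) · f(y))`. -/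
def sdpObjective {V : Type} [Fintype V] (n : ℕ) (A : Matrix V V ℝ) (f : V → Sphere n) : ℝ :=
  ∑ x, ∑ y, A x y * (1 - dot (f x) (f y))

/-- The maximum of the objective over all `f : V → S^{n-1}`. -/
def sdp {V : Type} [Fintype V] (n : ℕ) (A : Matrix V V ℝ) : ℝ :=
  ⨆ f : V → Sphere n, sdpObjective n A f

/-- For `n ≥ 1` the supremum that defines `sdp n A` is an attained maximum. -/
theorem exists_isMaxOn_sdpObjective {V : Type} [Fintype V] {n : ℕ} (hn : 1 ≤ n)
    (A : Matrix V V ℝ) :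
    ∃ f : V → Sphere n, IsGreatest (range (sdpObjective n A)) (sdpObjective n A f) ∧
      sdp n A = sdpObjective n A f := by
  have hne : Nonempty (V → Sphere n) :=
    ⟨fun _ => ⟨EuclideanSpace.single (⟨0, hn⟩ : Fin n) (1 : ℝ), by simp⟩⟩
  have hc : Continuous (sdpObjective n A) := by
    unfold sdpObjective dot
    fun_prop
  obtain ⟨f, -, hf⟩ := isCompact_univ.exists_isMaxOn univ_nonempty hc.continuousOn
  have hg : IsGreatest (range (sdpObjective n A)) (sdpObjective n A f) :=
    ⟨⟨f, rfl⟩, by rintro _ ⟨g, rfl⟩; exact hf (mem_univ g)⟩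
  exact ⟨f, hg, hg.csSup_eq⟩

/-- The ratios `sdp_n(A) / sdp_1(A)`, over all nonnegative matrices `A` on a finite nonempty index
set for which the ratio is defined.  (The excluded matrices, those with `sdp_1(A) = 0`, vanish off
the diagonal and also have `sdp_n(A) = 0`.) -/
def gapRatios (n : ℕ) : Set ℝ :=
  {r | ∃ (m : ℕ) (A : Matrix (Fin (m + 1)) (Fin (m + 1)) ℝ),
    (∀ x y, 0 ≤ A x y) ∧ sdp 1 A ≠ 0 ∧ r = sdp n A / sdp 1 A}

/-- The `n`-dimensional integrality gap. -/
def gammaGap (n : ℕ) : ℝ := sSup (gapRatios n)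

/-- The reciprocal of the `n`-dimensional integrality gap. -/
def alphaGap (n : ℕ) : ℝ := (gammaGap n)⁻¹

/-! ### The Goemans–Williamson constant -/

/-- The function `t ↦ (2/π) arcsin t`. -/
def KGW (t : ℝ) : ℝ := 2 / Real.pi * Real.arcsin t

/-- The ratio `(1 - (2/π) arcsin t) / (1 - t)`, considered for `t ∈ [-1, 1)`. -/
def gwRatio (t : ℝ) : ℝ := (1 - KGW t) / (1 - t)

/-- The Goemans–Williamson constant: the minimum of `gwRatio` on its domain `[-1, 1)`. -/
def alphaGW : ℝ := sInf (gwRatio '' Ico (-1) 1)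

/-- The minimum that defines `alphaGW` is attained. -/
theorem exists_gwRatio_eq_alphaGW :
    ∃ t ∈ Ico (-1 : ℝ) 1, IsLeast (gwRatio '' Ico (-1) 1) (gwRatio t) ∧ gwRatio t = alphaGW := by
  have hc : ContinuousOn gwRatio (Icc (-1) 0) := by
    unfold gwRatio KGW
    refine ContinuousOn.div (by fun_prop) (by fun_prop) ?_
    intro t ht
    have := ht.2
    linarith
  obtain ⟨t, ht, hmin⟩ := isCompact_Icc.exists_isMinOn ⟨0, by simp⟩ hc
  have h0 : gwRatio 0 = 1 := by simp [gwRatio, KGW]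
  have key : ∀ s ∈ Ico (-1 : ℝ) 1, gwRatio t ≤ gwRatio s := by
    intro s hs
    rcases le_total s 0 with h | h
    · exact hmin ⟨hs.1, h⟩
    · have h1 : gwRatio t ≤ 1 := h0 ▸ hmin (show (0 : ℝ) ∈ Icc (-1 : ℝ) 0 by simp)
      refine h1.trans ?_
      unfold gwRatio
      rw [le_div_iff₀ (by linarith [hs.2])]
      have h2 := Real.mul_le_sin (Real.arcsin_nonneg.2 h) (Real.arcsin_le_pi_div_two s)
      rw [Real.sin_arcsin hs.1 hs.2.le] at h2
      unfold KGW
      linarith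
  have hl : IsLeast (gwRatio '' Ico (-1) 1) (gwRatio t) :=
    ⟨⟨t, ⟨ht.1, by linarith [ht.2]⟩, rfl⟩, by rintro _ ⟨s, hs, rfl⟩; exact key s hs⟩
  exact ⟨t, ⟨ht.1, by linarith [ht.2]⟩, hl, hl.csInf_eq.symm⟩

/-! ### Cut polytopes -/

/-- The cut polytope of a finite set `U`: the convex hull of the matrices `(f(x) f(y))_{x,y}`
with `f : U → {-1, 1}`. -/
def cutPolytope (U : Type) : Set (Matrix U U ℝ) :=
  convexHull ℝ {M | ∃ f : U → ℝ, (∀ x, f x = 1 ∨ f x = -1) ∧ M = Matrix.vecMulVec f f}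

/-- The cut polytope of the sphere: the continuous kernels whose restriction to every finite
nonempty `U ⊆ S^{n-1}` lies in the cut polytope of `U`. -/
def cutPolytopeSphere (n : ℕ) : Set (Sphere n → Sphere n → ℝ) :=
  {K | Continuous (fun p : Sphere n × Sphere n => K p.1 p.2) ∧
    ∀ U : Finset (Sphere n), U.Nonempty →
      Matrix.of (fun x y : U => K x y) ∈ cutPolytope U}

/-! ### The orthogonal group, invariant kernels, and averaging -/

/-- The group `O(n)` of orthogonal `n × n` matrices. -/
abbrev O (n : ℕ) : Submonoid (Matrix (Fin n) (Fin n) ℝ) := Matrix.orthogonalGroup (Fin n) ℝ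

/-- The action `x ↦ T x` of an orthogonal matrix on the sphere. -/
def act {n : ℕ} (T : O n) (x : Sphere n) : Sphere n :=
  ⟨Matrix.toEuclideanCLM (𝕜 := ℝ) (T : Matrix (Fin n) (Fin n) ℝ) x, by
    have hx : ‖(x : EuclideanSpace ℝ (Fin n))‖ = 1 := by simp
    have hT : Matrix.toEuclideanCLM (𝕜 := ℝ) (T : Matrix (Fin n) (Fin n) ℝ) ∈
        unitary (EuclideanSpace ℝ (Fin n) →L[ℝ] EuclideanSpace ℝ (Fin n)) :=
      Unitary.map_mem _ T.2
    have h := ContinuousLinearMap.norm_map_of_mem_unitary hT (x : EuclideanSpace ℝ (Fin n))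
    simpa [hx] using h⟩

/-- A kernel is invariant if `K(Tx, Ty) = K(x, y)` for all `T ∈ O(n)`. -/
def IsInvariant {n : ℕ} (K : Sphere n → Sphere n → ℝ) : Prop :=
  ∀ (T : O n) (x y : Sphere n), K (act T x) (act T y) = K x y

/-- `K(t)`: the common value that an invariant kernel `K` takes on the pairs `(x, y)` with
`x · y = t` (and `0` if there is no such pair). -/
def valueAt {n : ℕ} (K : Sphere n → Sphere n → ℝ) : ℝ → ℝ :=
  Function.extend (fun p : Sphere n × Sphere n => dot p.1 p.2) (fun p => K p.1 p.2) 0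
/-- `O(n)` acts transitively on the pairs of points of the sphere with a given inner product. -/
theorem exists_act_eq {n : ℕ} {x y x' y' : Sphere n} (h : dot x y = dot x' y') :
    ∃ T : O n, act T x = x' ∧ act T y = y' := by
  let E := EuclideanSpace ℝ (Fin n)
  have hs : ∀ z : Sphere n, ‖(z : E)‖ = 1 := fun z => by simp
  obtain ⟨e, hx, hy⟩ : ∃ e : E ≃ₗᵢ[ℝ] E, e x = x' ∧ e y = y' := by
    let r₁ := (ℝ ∙ ((x : E) - x'))ᗮ.reflection
    have h1 : r₁ x = x' := Submodule.reflection_sub (by rw [hs, hs])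
    let r₂ := (ℝ ∙ (r₁ (y : E) - y'))ᗮ.reflection
    have h2 : r₂ (r₁ y) = y' := Submodule.reflection_sub (by rw [r₁.norm_map, hs, hs])
    have h3 : r₂ x' = x' := by
      apply Submodule.reflection_mem_subspace_eq_self
      rw [Submodule.mem_orthogonal_singleton_iff_inner_right, inner_sub_left, sub_eq_zero]
      have : inner ℝ (r₁ (y : E)) (x' : E) = inner ℝ (y : E) (x : E) := by
        rw [← h1, r₁.inner_map_map]
      rw [this, real_inner_comm, real_inner_comm (x' : E)]
      exact h
    exact ⟨r₁.trans r₂, by simp [h1, h3], by simp [h2]⟩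
  let A : Matrix (Fin n) (Fin n) ℝ :=
    (Matrix.toEuclideanCLM (n := Fin n) (𝕜 := ℝ)).symm (e.toContinuousLinearEquiv : E →L[ℝ] E)
  have hA : Matrix.toEuclideanCLM (n := Fin n) (𝕜 := ℝ) A =
      (e.toContinuousLinearEquiv : E →L[ℝ] E) := StarAlgEquiv.apply_symm_apply _ _
  have hu : (e.toContinuousLinearEquiv : E →L[ℝ] E) ∈ unitary (E →L[ℝ] E) :=
    (Unitary.linearIsometryEquiv.symm e).2
  have hU : A ∈ O n := by
    rw [Matrix.mem_unitaryGroup_iff]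
    apply EquivLike.injective (Matrix.toEuclideanCLM (n := Fin n) (𝕜 := ℝ))
    rw [map_mul, map_star, map_one, hA]
    exact (Unitary.mem_iff.1 hu).2
  refine ⟨⟨A, hU⟩, Subtype.ext ?_, Subtype.ext ?_⟩
  · simp [act, hA, hx]
  · simp [act, hA, hy]

/-- For `n ≥ 2` every `t ∈ [-1, 1]` is the inner product of two points of the sphere. -/
theorem exists_dot_eq {n : ℕ} (hn : 2 ≤ n) {t : ℝ} (ht : t ∈ Icc (-1 : ℝ) 1) :
    ∃ x y : Sphere n, dot x y = t := by
  let i : Fin n := ⟨0, by omega⟩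
  let j : Fin n := ⟨1, by omega⟩
  have hij : i ≠ j := by simp [i, j]
  have h1 : inner ℝ (EuclideanSpace.single i (1 : ℝ)) (EuclideanSpace.single j (1 : ℝ)) = 0 := by
    rw [EuclideanSpace.inner_single_left]
    simp [hij]
  have h2 := real_inner_comm (EuclideanSpace.single i (1 : ℝ)) (EuclideanSpace.single j (1 : ℝ))
  rw [h1] at h2
  have h0 : 0 ≤ 1 - t ^ 2 := by nlinarith [ht.1, ht.2]
  let u : EuclideanSpace ℝ (Fin n) := EuclideanSpace.single i 1
  let v : EuclideanSpace ℝ (Fin n) :=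
    t • EuclideanSpace.single i (1 : ℝ) + √(1 - t ^ 2) • EuclideanSpace.single j (1 : ℝ)
  have hv : ‖v‖ ^ 2 = 1 := by
    rw [← real_inner_self_eq_norm_sq]
    simp only [v, inner_add_left, inner_add_right, real_inner_smul_left, real_inner_smul_right]
    simp [h1, h2]
    nlinarith [Real.mul_self_sqrt h0]
  have hv1 : ‖v‖ = 1 := by nlinarith [norm_nonneg v]
  refine ⟨⟨u, by simp [u]⟩, ⟨v, by simp [hv1]⟩, ?_⟩
  simp [dot, u, v, inner_add_right, real_inner_smul_right, h1]

/-- An invariant kernel depends only on the inner product, and `valueAt` is that dependence. -/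
theorem valueAt_dot {n : ℕ} {K : Sphere n → Sphere n → ℝ} (hK : IsInvariant K)
    (x y : Sphere n) : valueAt K (dot x y) = K x y := by
  refine Function.FactorsThrough.extend_apply
    (f := fun p : Sphere n × Sphere n => dot p.1 p.2) (g := fun p => K p.1 p.2) ?_ 0 (x, y)
  rintro ⟨a, b⟩ ⟨c, d⟩ h
  obtain ⟨T, rfl, rfl⟩ := exists_act_eq h
  exact (hK T a b).symm

instance (n : ℕ) : MeasurableSpace (O n) := borel _

instance (n : ℕ) : BorelSpace (O n) := ⟨rfl⟩

instance (n : ℕ) : CompactSpace (O n) := by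
  have hcl : IsClosed (O n : Set (Matrix (Fin n) (Fin n) ℝ)) := by
    have : (O n : Set (Matrix (Fin n) (Fin n) ℝ)) = {A | A * star A = 1} := by
      ext A; exact Matrix.mem_unitaryGroup_iff
    rw [this]
    exact isClosed_eq (by fun_prop) continuous_const
  have hco : IsCompact (Set.pi univ fun _ : Fin n => Set.pi univ fun _ : Fin n =>
      Icc (-1 : ℝ) 1) :=
    isCompact_univ_pi fun _ => isCompact_univ_pi fun _ => isCompact_Icc
  refine isCompact_iff_compactSpace.1 (hco.of_isClosed_subset hcl ?_)
  intro A hA i _ j _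
  have h := entry_norm_bound_of_unitary hA i j
  exact abs_le.1 h

/-- The Haar measure on `O(n)`, normalized to total measure `1`. -/
def haarO (n : ℕ) : Measure (O n) :=
  Measure.haarMeasure ⟨⟨univ, isCompact_univ⟩, by simp⟩

instance (n : ℕ) : IsProbabilityMeasure (haarO n) := ⟨Measure.haarMeasure_self⟩

/-- The Reynolds operator `R(K)(x, y) = ∫_{O(n)} K(Tx, Ty) dμ(T)`. -/
def reynolds {n : ℕ} (K : Sphere n → Sphere n → ℝ) : Sphere n → Sphere n → ℝ :=
  fun x y => ∫ T, K (act T x) (act T y) ∂(haarO n)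

/-- The kernel `f ⊗ f*`, mapping `(x, y)` to `f(x) f(y)`. -/
def tensorSelf {n : ℕ} (f : Sphere n → ℝ) : Sphere n → Sphere n → ℝ :=
  fun x y => f x * f y

end MaxCut

end

/-!
The two directions have different proofs.

*A kernel gives a bound.*  If `K` lies in the cut polytope of the sphere and
`α (1 - x · y) ≤ 1 - K(x, y)` for all `x, y`, then restricting `K` to the points of an optimal
configuration for `sdp n A` gives a convex combination of cut matrices, so that
`α * sdp n A ≤ sdp 1 A` (`mul_sdp_le_of_mem_cutPolytopeSphere`) and `α ≤ α_n`.  The kernel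
`(2/π) arcsin (x · y)` lies in the cut polytope, being the average over `O(n)` of a half-space cut
(`reynolds_lexSign`); hence `α_GW ≤ α_n`.  It has ratio `(1 - K(t)) / (1 - t) > α_GW` at every
`t ≠ t_GW`, as the minimizer is unique (`eq_of_gwRatio_eq_alphaGW`).  So if an invariant `K` beats
it at `t_GW`, then a convex combination with a small weight on `K` has, by compactness, ratio
bounded below by some `β > α_GW` (`alphaGW_lt_alphaGap_of_lt`).

*A bound gives a cut.*  Fix `x · y = t_GW` and suppose that no measurable cut `f` separates `T x`
from `T y`, for a Haar-random `T ∈ O(n)`, with larger probability than a half space does.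
Partition the sphere into small cells and let `A(u, v)` be the probability that `T x` is in the cell
`u` and `T y` in the cell `v`.  Cuts of the cells are measurable cuts of the sphere, so
`sdp 1 A ≤ α_GW (1 - t_GW)`, while the centres of the cells show that `sdp n A` is at least
`1 - t_GW` up to an error that tends to zero.  Thus `α_n ≤ α_GW` (`alphaGap_le_of_forall_isCut`).
No duality or compactness argument is needed for this direction.

That `R(f ⊗ f*)` belongs to the cut polytope for every measurable cut `f` (`IsCut.reynolds_mem`)
rests on the continuity of translations in `L¹`, on the invariance of the Haar measure on both
sides, and on the compactness of the cut polytope of a finite set.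
-/

namespace MaxCut

variable {n : ℕ}

/-! ### Averaging over the orthogonal group -/

theorem act_mul (T S : O n) (x : Sphere n) : act (T * S) x = act T (act S x) := by
  apply Subtype.ext
  simp [act]

theorem dot_act (T : O n) (x y : Sphere n) : dot (act T x) (act T y) = dot x y := by
  have hT : Matrix.toEuclideanCLM (𝕜 := ℝ) (T : Matrix (Fin n) (Fin n) ℝ) ∈
      unitary (EuclideanSpace ℝ (Fin n) →L[ℝ] EuclideanSpace ℝ (Fin n)) :=
    Unitary.map_mem _ T.2
  exact ContinuousLinearMap.inner_map_map_of_mem_unitary hT _ _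

@[simp]
theorem dot_self (x : Sphere n) : dot x x = 1 := by
  simp [dot]

theorem abs_dot_le_one (x y : Sphere n) : |dot x y| ≤ 1 := by
  simpa [dot] using abs_real_inner_le_norm (x : EuclideanSpace ℝ (Fin n)) y

theorem dot_mem_Icc (x y : Sphere n) : dot x y ∈ Icc (-1 : ℝ) 1 :=
  abs_le.1 (abs_dot_le_one x y)

theorem continuous_dot : Continuous fun p : Sphere n × Sphere n => dot p.1 p.2 := by
  unfold dot
  fun_prop

theorem continuous_act_left (x : Sphere n) : Continuous fun T : O n => act T x := by
  refine Continuous.subtype_mk ?_ _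
  have h : ∀ T : O n, Matrix.toEuclideanCLM (𝕜 := ℝ) (T : Matrix (Fin n) (Fin n) ℝ)
      (x : EuclideanSpace ℝ (Fin n)) =
      WithLp.toLp 2 (Matrix.mulVec (T : Matrix (Fin n) (Fin n) ℝ) (WithLp.ofLp x.1)) :=
    fun T => rfl
  simp only [h]
  fun_prop

theorem continuous_act (T : O n) : Continuous (act T : Sphere n → Sphere n) := by
  refine Continuous.subtype_mk ?_ _
  fun_prop

theorem measurable_act_left (x : Sphere n) : Measurable fun T : O n => act T x :=
  (continuous_act_left x).measurable

/-- The Haar measure of the compact group `O(n)` is invariant under right translations as well: a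
right translate is again a Haar probability measure, so it is the same measure. -/
instance : (haarO n).IsMulRightInvariant where
  map_mul_right_eq_self g := by
    have : (haarO n).IsHaarMeasure := by unfold haarO; infer_instance
    have : IsProbabilityMeasure ((haarO n).map (· * g)) :=
      Measure.isProbabilityMeasure_map (by fun_prop)
    exact Measure.isHaarMeasure_eq_of_isProbabilityMeasure _ _

/-- For every point `x`, the image `T x` under a Haar-random `T` has the same distribution. -/
theorem map_act_eq (x y : Sphere n) :
    (haarO n).map (fun T => act T x) = (haarO n).map (fun T => act T y) := by
  obtain ⟨S, hS, -⟩ := exists_act_eq (show dot y y = dot x x by simp)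
  subst hS
  simp only [← act_mul]
  conv_rhs => rw [← map_mul_right_eq_self (haarO n) S]
  rw [Measure.map_map (measurable_act_left y) (measurable_mul_const S)]
  rfl

/-- A cut of the sphere: a measurable function with values `±1`. -/
structure IsCut (f : Sphere n → ℝ) : Prop where
  measurable : Measurable f
  eq_or_eq : ∀ x, f x = 1 ∨ f x = -1

theorem IsCut.abs_eq {f : Sphere n → ℝ} (hf : IsCut f) (x : Sphere n) : |f x| = 1 := by
  rcases hf.eq_or_eq x with h | h <;> simp [h]

theorem IsCut.mul_self {f : Sphere n → ℝ} (hf : IsCut f) (x : Sphere n) : f x * f x = 1 := by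
  rcases hf.eq_or_eq x with h | h <;> simp [h]

theorem IsCut.integrable_mul {f : Sphere n → ℝ} (hf : IsCut f) (x y : Sphere n) :
    Integrable (fun T => f (act T x) * f (act T y)) (haarO n) := by
  refine Integrable.of_bound (C := 1) ?_ (.of_forall fun T => ?_)
  · exact ((hf.measurable.comp (measurable_act_left x)).mul
      (hf.measurable.comp (measurable_act_left y))).aestronglyMeasurable
  · simp [hf.abs_eq]

theorem isInvariant_reynolds (K : Sphere n → Sphere n → ℝ) : IsInvariant (reynolds K) := by
  intro S x y
  simp only [reynolds, ← act_mul]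
  exact integral_mul_right_eq_self (fun T => K (act T x) (act T y)) S

/-- Translations are continuous in `L¹`: this is clear for a bounded continuous function in place
of `f`, and such functions approximate `f` in `L¹` uniformly in `x`, as the distribution of `T x`
does not depend on `x`. -/
theorem IsCut.tendsto_integral_abs_sub {f : Sphere n → ℝ} (hf : IsCut f) (x : Sphere n) :
    Filter.Tendsto (fun x' => ∫ T, |f (act T x') - f (act T x)| ∂(haarO n))
      (nhds x) (nhds 0) := by
  have hprob : IsProbabilityMeasure ((haarO n).map (fun T => act T x)) :=
    Measure.isProbabilityMeasure_map (measurable_act_left x).aemeasurable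
  have hfi : Integrable f ((haarO n).map (fun T => act T x)) :=
    Integrable.of_bound (C := 1) hf.measurable.aestronglyMeasurable
      (.of_forall fun y => by simp [hf.abs_eq])
  rw [Metric.tendsto_nhds]
  intro ε hε
  obtain ⟨φ, hφ, -⟩ := hfi.exists_boundedContinuous_integral_sub_le (ε := ε / 4) (by linarith)
  have hφm : Measurable φ := φ.continuous.measurable
  have happrox : ∀ y, ∫ T, |f (act T y) - φ (act T y)| ∂(haarO n) ≤ ε / 4 := by
    intro y
    rw [map_act_eq x y] at hφ
    have h := integral_map (measurable_act_left y).aemeasurable (μ := haarO n)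
      (f := fun z => ‖f z - φ z‖) (hf.measurable.sub hφm).norm.aestronglyMeasurable
    exact h.symm.trans_le hφ
  have hint1 : ∀ y, Integrable (fun T => |f (act T y) - φ (act T y)|) (haarO n) := by
    intro y
    refine Integrable.of_bound (C := 1 + ‖φ‖)
      ((hf.measurable.sub hφm).comp (measurable_act_left y)).norm.aestronglyMeasurable
      (.of_forall fun T => ?_)
    rw [Real.norm_eq_abs, abs_abs]
    exact (abs_sub _ _).trans (add_le_add (hf.abs_eq _).le (φ.norm_coe_le_norm _))
  have hbound : ∀ y T, ‖|φ (act T y) - φ (act T x)|‖ ≤ ‖φ‖ + ‖φ‖ := by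
    intro y T
    rw [Real.norm_eq_abs, abs_abs]
    exact (abs_sub _ _).trans (add_le_add (φ.norm_coe_le_norm _) (φ.norm_coe_le_norm _))
  have hmeas2 : ∀ y, AEStronglyMeasurable (fun T => |φ (act T y) - φ (act T x)|) (haarO n) :=
    fun y => ((hφm.comp (measurable_act_left y)).sub
      (hφm.comp (measurable_act_left x))).norm.aestronglyMeasurable
  have hint2 : ∀ y, Integrable (fun T => |φ (act T y) - φ (act T x)|) (haarO n) :=
    fun y => Integrable.of_bound (hmeas2 y) _ (.of_forall (hbound y))
  have hcont : Continuous fun y => ∫ T, |φ (act T y) - φ (act T x)| ∂(haarO n) :=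
    continuous_of_dominated hmeas2 (fun y => .of_forall (hbound y)) (integrable_const _)
      (.of_forall fun T => ((φ.continuous.comp (continuous_act T)).sub continuous_const).abs)
  have hlim := hcont.tendsto x
  simp only [sub_self, abs_zero, integral_zero] at hlim
  filter_upwards [(Metric.tendsto_nhds.1 hlim) (ε / 4) (by linarith)] with y hy
  rw [Real.dist_eq, sub_zero] at hy ⊢
  rw [abs_of_nonneg (integral_nonneg fun T => abs_nonneg _)] at hy ⊢
  have hle : ∫ T, |f (act T y) - f (act T x)| ∂(haarO n) ≤
      ∫ T, (|f (act T y) - φ (act T y)| + |φ (act T y) - φ (act T x)|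
        + |f (act T x) - φ (act T x)|) ∂(haarO n) := by
    refine integral_mono_of_nonneg (.of_forall fun T => abs_nonneg _)
      (((hint1 y).add (hint2 y)).add (hint1 x)) (.of_forall fun T => ?_)
    have h1 := abs_sub_le (f (act T y)) (φ (act T y)) (f (act T x))
    have h2 := abs_sub_le (φ (act T y)) (φ (act T x)) (f (act T x))
    rw [abs_sub_comm (φ (act T x))] at h2
    simp only
    linarith
  rw [integral_add (by exact (hint1 y).add (hint2 y)) (hint1 x),
    integral_add (hint1 y) (hint2 y)] at hle
  linarith [happrox x, happrox y]

theorem IsCut.continuous_reynolds {f : Sphere n → ℝ} (hf : IsCut f) :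
    Continuous fun p : Sphere n × Sphere n => reynolds (tensorSelf f) p.1 p.2 := by
  rw [continuous_iff_continuousAt]
  rintro ⟨x, y⟩
  have hint : ∀ u v, Integrable (fun T => |f (act T u) - f (act T v)|) (haarO n) := by
    intro u v
    refine Integrable.of_bound (C := 2) ((hf.measurable.comp (measurable_act_left u)).sub
      (hf.measurable.comp (measurable_act_left v))).norm.aestronglyMeasurable
      (.of_forall fun T => ?_)
    rw [Real.norm_eq_abs, abs_abs]
    refine (abs_sub _ _).trans ?_
    rw [hf.abs_eq, hf.abs_eq]
    norm_num
  have hlim : Filter.Tendsto (fun p : Sphere n × Sphere n =>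
      ∫ T, |f (act T p.1) - f (act T x)| ∂(haarO n) + ∫ T, |f (act T p.2) - f (act T y)| ∂(haarO n))
      (nhds (x, y)) (nhds 0) := by
    have h := ((hf.tendsto_integral_abs_sub x).comp (continuous_fst.tendsto (x, y))).add
      ((hf.tendsto_integral_abs_sub y).comp (continuous_snd.tendsto (x, y)))
    simpa using h
  refine tendsto_iff_dist_tendsto_zero.2 (squeeze_zero (fun _ => dist_nonneg) (fun p => ?_) hlim)
  rw [Real.dist_eq, ← integral_add (hint _ _) (hint _ _)]
  simp only [reynolds, tensorSelf]
  rw [← integral_sub (hf.integrable_mul _ _) (hf.integrable_mul _ _)]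
  refine (abs_integral_le_integral_abs).trans
    (integral_mono ((hf.integrable_mul _ _).sub (hf.integrable_mul _ _)).abs
      ((hint _ _).add (hint _ _)) fun T => ?_)
  have h : f (act T p.1) * f (act T p.2) - f (act T x) * f (act T y) =
      (f (act T p.1) - f (act T x)) * f (act T p.2) + f (act T x) * (f (act T p.2) - f (act T y)) :=
    by ring
  simp only [h]
  refine (abs_add_le _ _).trans ?_
  rw [abs_mul, abs_mul, hf.abs_eq, hf.abs_eq, mul_one, one_mul]

/-! ### Kernels in the cut polytope -/

theorem finite_cutMatrices (U : Type) [Finite U] :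
    {M : Matrix U U ℝ | ∃ f : U → ℝ, (∀ x, f x = 1 ∨ f x = -1) ∧
      M = Matrix.vecMulVec f f}.Finite := by
  have h : {f : U → ℝ | ∀ x, f x ∈ ({1, -1} : Set ℝ)}.Finite :=
    (Set.Finite.pi' fun _ => Set.toFinite _)
  refine (h.image fun f => Matrix.vecMulVec f f).subset ?_
  rintro M ⟨f, hf, rfl⟩
  exact ⟨f, hf, rfl⟩

/-- Averages of cut matrices belong to the cut polytope, which is convex and compact. -/
theorem IsCut.reynolds_mem {f : Sphere n → ℝ} (hf : IsCut f) :
    reynolds (tensorSelf f) ∈ cutPolytopeSphere n := by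
  refine ⟨hf.continuous_reynolds, fun U _ => ?_⟩
  have hint : Integrable (fun T : O n => fun x y : U => f (act T x) * f (act T y)) (haarO n) :=
    Integrable.of_eval fun x => Integrable.of_eval fun y => hf.integrable_mul _ _
  have hcl : IsClosed (cutPolytope U) := (finite_cutMatrices U).isClosed_convexHull ℝ
  have hconv : Convex ℝ (cutPolytope U) := convex_convexHull ℝ _
  have hmem : ∀ T : O n,
      Matrix.vecMulVec (fun x : U => f (act T x)) (fun x : U => f (act T x)) ∈ cutPolytope U :=
    fun T => subset_convexHull ℝ _ ⟨fun x : U => f (act T x), fun x => hf.eq_or_eq _, rfl⟩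
  have h := Convex.integral_mem (E := U → U → ℝ) (s := cutPolytope U)
    (f := fun T => fun x y : U => f (act T x) * f (act T y)) hconv hcl
    (.of_forall hmem) hint
  have heq : (fun x y : U => reynolds (tensorSelf f) x y) =
      ∫ T, (fun x y : U => f (act T x) * f (act T y)) ∂(haarO n) := by
    ext x y
    rw [eval_integral fun x => Integrable.of_eval fun y => hf.integrable_mul _ _,
      eval_integral fun y => hf.integrable_mul _ _]
    rfl
  rw [← heq] at h
  exact h

/-- Every linear inequality that holds for the cut matrices holds on the cut polytope. -/
theorem le_of_mem_cutPolytope {U : Type} {M : Matrix U U ℝ} (hM : M ∈ cutPolytope U)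
    {l : Matrix U U ℝ →ₗ[ℝ] ℝ} {c : ℝ}
    (h : ∀ f : U → ℝ, (∀ x, f x = 1 ∨ f x = -1) → l (Matrix.vecMulVec f f) ≤ c) : l M ≤ c := by
  refine convexHull_min (s := _) (t := {M | l M ≤ c}) ?_ ?_ hM
  · rintro _ ⟨f, hf, rfl⟩
    exact h f hf
  · exact convex_halfSpace_le l.isLinear c

theorem le_one_of_mem_cutPolytopeSphere {K : Sphere n → Sphere n → ℝ}
    (hK : K ∈ cutPolytopeSphere n) (x y : Sphere n) : K x y ≤ 1 := by
  classical
  have hM := hK.2 {x, y} ⟨x, by simp⟩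
  refine le_of_mem_cutPolytope hM
    (l := Matrix.entryLinearMap ℝ ℝ (⟨x, by simp⟩ : ({x, y} : Finset (Sphere n))) ⟨y, by simp⟩) ?_
  intro f hf
  simp only [Matrix.entryLinearMap_apply, Matrix.vecMulVec_apply]
  rcases hf ⟨x, by simp⟩ with h | h <;> rcases hf ⟨y, by simp⟩ with h' | h' <;> simp [h, h']

/-! ### The Goemans–Williamson kernel -/

/-- The first nonzero coordinate of `x` is positive. -/
def LexPos (x : EuclideanSpace ℝ (Fin n)) : Prop :=
  ∃ i, (∀ j < i, x j = 0) ∧ 0 < x i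

theorem LexPos.smul_add_smul {x y : EuclideanSpace ℝ (Fin n)} (hx : LexPos x) (hy : LexPos y)
    {a b : ℝ} (ha : 0 < a) (hb : 0 < b) : LexPos (a • x + b • y) := by
  obtain ⟨i, hi, hi'⟩ := hx
  obtain ⟨j, hj, hj'⟩ := hy
  rcases lt_trichotomy i j with h | rfl | h
  · exact ⟨i, fun k hk => by simp [hi k hk, hj k (hk.trans h)], by simp [hj i h, ha, hi']⟩
  · exact ⟨i, fun k hk => by simp [hi k hk, hj k hk], by simp; positivity⟩
  · exact ⟨j, fun k hk => by simp [hj k hk, hi k (hk.trans h)], by simp [hi j h, hb, hj']⟩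

theorem LexPos.not_neg {x : EuclideanSpace ℝ (Fin n)} (hx : LexPos x) : ¬ LexPos (-x) := by
  intro h
  obtain ⟨i, -, hi⟩ := hx.smul_add_smul h one_pos one_pos
  simp at hi

theorem lexPos_or_lexPos_neg {x : EuclideanSpace ℝ (Fin n)} (hx : x ≠ 0) :
    LexPos x ∨ LexPos (-x) := by
  have hne : {i | x i ≠ 0}.Nonempty := by
    by_contra h
    refine hx (PiLp.ext fun i => ?_)
    by_contra hi
    exact h ⟨i, hi⟩
  obtain ⟨i, hi, hmin⟩ := wellFounded_lt.has_min {i | x i ≠ 0} hne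
  have h0 : ∀ j < i, x j = 0 := fun j hj => by
    by_contra h
    exact hmin j h hj
  rcases lt_or_gt_of_ne (show x i ≠ 0 from hi) with h | h
  · exact .inr ⟨i, fun j hj => by simp [h0 j hj], by simpa using h⟩
  · exact .inl ⟨i, h0, h⟩

open Classical in
/-- The sign of the first nonzero coordinate.  This is the cut by a hyperplane with the boundary
split by lower-dimensional hyperplanes, so that antipodal points are always separated. -/
noncomputable def lexSign (x : Sphere n) : ℝ :=
  if LexPos (x : EuclideanSpace ℝ (Fin n)) then 1 else -1

theorem isCut_lexSign : IsCut (lexSign : Sphere n → ℝ) where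
  measurable := by
    refine Measurable.ite ?_ measurable_const measurable_const
    have hc : ∀ i, Measurable fun x : Sphere n => (x : EuclideanSpace ℝ (Fin n)) i :=
      fun i => Continuous.measurable (by fun_prop)
    simp only [LexPos, ofPred_exists, ofPred_and, ofPred_forall]
    exact MeasurableSet.iUnion fun i => (MeasurableSet.iInter fun j => MeasurableSet.iInter
      fun _ => measurableSet_eq_fun (hc j) measurable_const).inter
        (measurableSet_lt measurable_const (hc i))
  eq_or_eq x := by
    unfold lexSign
    split_ifs <;> simp

theorem lexSign_neg (x : Sphere n) : lexSign (-x) = -lexSign x := by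
  have hx : (x : EuclideanSpace ℝ (Fin n)) ≠ 0 := by
    intro h
    simpa [h] using (norm_eq_of_mem_sphere x)
  unfold lexSign
  rcases lexPos_or_lexPos_neg hx with h | h
  · simp [h, h.not_neg]
  · have h' := h.not_neg
    rw [neg_neg] at h'
    simp [h, h']

/-- If `y` lies on the arc between `x` and `z`, then a half space that does not separate `x` from
`z` separates neither from `y`, and one that does separates `y` from exactly one of them. -/
theorem one_sub_lexSign_mul {x y z : Sphere n} {a b c : ℝ} (ha : 0 < a) (hb : 0 < b) (hc : 0 < c)
    (h : c • (y : EuclideanSpace ℝ (Fin n)) = a • (x : EuclideanSpace ℝ (Fin n)) + b • (z : _)) :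
    1 - lexSign x * lexSign z = (1 - lexSign x * lexSign y) + (1 - lexSign y * lexSign z) := by
  have key : ∀ {x y z : Sphere n},
      c • (y : EuclideanSpace ℝ (Fin n)) = a • (x : EuclideanSpace ℝ (Fin n)) + b • (z : _) →
      lexSign x = 1 → lexSign z = 1 → lexSign y = 1 := by
    intro x y z h hx hz
    have hpos : ∀ {w : Sphere n}, lexSign w = 1 → LexPos (w : EuclideanSpace ℝ (Fin n)) := by
      intro w hw
      by_contra h'
      simp [lexSign, h'] at hw
      norm_num at hw
    have hcy : LexPos (c • (y : EuclideanSpace ℝ (Fin n))) :=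
      h ▸ (hpos hx).smul_add_smul (hpos hz) ha hb
    obtain ⟨i, hi, hi'⟩ := hcy
    have hy : LexPos (y : EuclideanSpace ℝ (Fin n)) :=
      ⟨i, fun j hj => by simpa [hc.ne'] using hi j hj, by simpa [hc] using hi'⟩
    simp [lexSign, hy]
  rcases isCut_lexSign.eq_or_eq x with hx | hx <;> rcases isCut_lexSign.eq_or_eq z with hz | hz
  · rw [hx, hz, key h hx hz]
    norm_num
  · rw [hx, hz]
    ring
  · rw [hx, hz]
    ring
  · have hneg : lexSign (-y) = 1 := by
      refine key (x := -x) (z := -z) ?_ (by rw [lexSign_neg, hx, neg_neg])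
        (by rw [lexSign_neg, hz, neg_neg])
      simp only [Metric.sphere, coe_neg_sphere, smul_neg, h, neg_add]
    have hy : lexSign y = -1 := by
      rw [lexSign_neg] at hneg
      linarith
    rw [hx, hz, hy]
    norm_num

/-- A bounded function that satisfies Cauchy's equation on `[0, π]` and vanishes at `π` is zero:
doubling the argument, after a reflection at `π / 2` if necessary, doubles the absolute value. -/
theorem eq_zero_of_additive_of_bounded {d : ℝ → ℝ} {B : ℝ}
    (hadd : ∀ a b, 0 ≤ a → 0 ≤ b → a + b ≤ Real.pi → d (a + b) = d a + d b)
    (hpi : d Real.pi = 0) (hB : ∀ a ∈ Icc 0 Real.pi, |d a| ≤ B) :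
    ∀ a ∈ Icc 0 Real.pi, d a = 0 := by
  have key : ∀ m : ℕ, ∀ a ∈ Icc 0 Real.pi, |d a| ≤ B * (1 / 2) ^ m := by
    intro m
    induction m with
    | zero => simpa using hB
    | succ m ih =>
      have half : ∀ a, 0 ≤ a → a ≤ Real.pi / 2 → |d a| ≤ B * (1 / 2) ^ (m + 1) := by
        intro a h0 h1
        have h := ih (a + a) ⟨by linarith, by linarith⟩
        rw [hadd a a h0 h0 (by linarith), ← two_mul, abs_mul, abs_two] at h
        rw [pow_succ]
        linarith
      rintro a ⟨h0, h1⟩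
      rcases le_total a (Real.pi / 2) with h | h
      · exact half a h0 h
      · have h2 := half (Real.pi - a) (by linarith) (by linarith)
        have h3 := hadd a (Real.pi - a) h0 (by linarith) (by linarith)
        rw [add_sub_cancel, hpi] at h3
        rwa [show d a = -d (Real.pi - a) by linarith, abs_neg]
  intro a ha
  have hlim : Filter.Tendsto (fun m : ℕ => B * (1 / 2 : ℝ) ^ m) Filter.atTop (nhds 0) := by
    simpa using (tendsto_pow_atTop_nhds_zero_of_lt_one (by norm_num : (0 : ℝ) ≤ 1 / 2)
      (by norm_num)).const_mul B
  exact abs_nonpos_iff.1 (ge_of_tendsto' hlim fun m => key m a ha)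

/-- A great circle, parametrized by the angle. -/
theorem exists_greatCircle (hn : 2 ≤ n) : ∃ (u v : EuclideanSpace ℝ (Fin n)) (c : ℝ → Sphere n),
    (∀ s, (c s : EuclideanSpace ℝ (Fin n)) = Real.cos s • u + Real.sin s • v) ∧
      ∀ s t, dot (c s) (c t) = Real.cos (t - s) := by
  obtain ⟨x, y, hxy⟩ := exists_dot_eq hn (t := 0) (by simp)
  have h1 : inner ℝ (x : EuclideanSpace ℝ (Fin n)) y = 0 := hxy
  have h2 : inner ℝ (y : EuclideanSpace ℝ (Fin n)) x = 0 := by rw [real_inner_comm, h1]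
  have hin : ∀ s t, inner ℝ
      (Real.cos s • (x : EuclideanSpace ℝ (Fin n)) + Real.sin s • (y : EuclideanSpace ℝ (Fin n)))
      (Real.cos t • (x : EuclideanSpace ℝ (Fin n)) + Real.sin t • (y : EuclideanSpace ℝ (Fin n))) =
      Real.cos (t - s) := by
    intro s t
    simp only [inner_add_left, inner_add_right, real_inner_smul_left, real_inner_smul_right,
      h1, h2, real_inner_self_eq_norm_sq, norm_eq_of_mem_sphere]
    rw [Real.cos_sub]
    ring
  have hnorm : ∀ s, ‖Real.cos s • (x : EuclideanSpace ℝ (Fin n)) +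
      Real.sin s • (y : EuclideanSpace ℝ (Fin n))‖ = 1 := by
    intro s
    have h := hin s s
    rw [real_inner_self_eq_norm_sq, sub_self, Real.cos_zero] at h
    exact (pow_eq_one_iff_of_nonneg (norm_nonneg _) two_ne_zero).1 h
  exact ⟨x, y, fun s => ⟨_, by simpa using hnorm s⟩, fun s => rfl, fun s t => hin s t⟩

/-- Grothendieck's identity: averaging a half-space cut over `O(n)` gives the kernel
`(2/π) arcsin (x · y)`.  The probability that a random half space separates two points at angle `θ`
is additive in `θ`, hence proportional to `θ`. -/
theorem reynolds_lexSign (hn : 2 ≤ n) (x y : Sphere n) :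
    reynolds (tensorSelf lexSign) x y = KGW (dot x y) := by
  obtain ⟨u, v, c, hc, hdot⟩ := exists_greatCircle hn
  set R : Sphere n → Sphere n → ℝ := reynolds (tensorSelf lexSign) with hR
  have hinv : ∀ {x y x' y' : Sphere n}, dot x y = dot x' y' → R x y = R x' y' := by
    intro x y x' y' h
    obtain ⟨T, rfl, rfl⟩ := exists_act_eq h
    exact (isInvariant_reynolds _ T x y).symm
  have hself : ∀ x, R x x = 1 := by
    intro x
    simp [hR, reynolds, tensorSelf, isCut_lexSign.mul_self]
  have hneg : ∀ x y, R x (-y) = -R x y := by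
    intro x y
    have hact : ∀ T : O n, act T (-y) = -act T y := fun T => Subtype.ext (by simp [act])
    simp only [hR, reynolds, tensorSelf, hact, lexSign_neg, mul_neg, integral_neg]
  have habs : ∀ x y, |R x y| ≤ 1 := by
    intro x y
    simp only [hR, reynolds, tensorSelf]
    refine (abs_integral_le_integral_abs).trans ?_
    simp [abs_mul, isCut_lexSign.abs_eq]
  have hcpi : c Real.pi = -c 0 := Subtype.ext (by simp [hc])
  have harc : ∀ {x y z : Sphere n} {a b c : ℝ}, 0 < a → 0 < b → 0 < c →
      c • (y : EuclideanSpace ℝ (Fin n)) = a • (x : EuclideanSpace ℝ (Fin n)) + b • (z : _) →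
      1 - R x z = (1 - R x y) + (1 - R y z) := by
    intro x y z a b c ha hb hc h
    have hT : ∀ T : O n, c • (act T y : EuclideanSpace ℝ (Fin n)) =
        a • (act T x : EuclideanSpace ℝ (Fin n)) + b • (act T z : EuclideanSpace ℝ (Fin n)) := by
      intro T
      simp only [act, ← map_smul, h, ← map_add]
    have hi := isCut_lexSign.integrable_mul (n := n)
    have h1 : ∀ x y : Sphere n, 1 - R x y =
        ∫ T, (1 - lexSign (act T x) * lexSign (act T y)) ∂(haarO n) := by
      intro x y
      rw [integral_sub (integrable_const _) (hi x y)]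
      simp [hR, reynolds, tensorSelf]
    rw [h1 x z, h1 x y, h1 y z, ← integral_add (by exact (integrable_const _).sub (hi x y))
      (by exact (integrable_const _).sub (hi y z))]
    exact integral_congr_ae (.of_forall fun T => one_sub_lexSign_mul ha hb hc (hT T))
  let q : ℝ → ℝ := fun s => 1 - R (c 0) (c s)
  have hq0 : q 0 = 0 := by simp [q, hself]
  have hqpi : q Real.pi = 2 := by
    simp only [q, hcpi, hneg, hself]
    norm_num
  have hshift : ∀ s t, 1 - R (c s) (c (s + t)) = q t := by
    intro s t
    simp only [q]
    rw [hinv (x' := c 0) (y' := c t)]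
    rw [hdot, hdot]
    simp
  have hqadd : ∀ a b, 0 ≤ a → 0 ≤ b → a + b ≤ Real.pi → q (a + b) = q a + q b := by
    intro a b ha hb hab
    rcases ha.eq_or_lt with rfl | ha
    · simp [hq0]
    rcases hb.eq_or_lt with rfl | hb
    · simp [hq0]
    rcases hab.eq_or_lt with hab | hab
    · have h := hshift a b
      rw [hab, hcpi, hneg] at h
      have hsymm : R (c a) (c 0) = R (c 0) (c a) := hinv (by
        rw [hdot, hdot, ← Real.cos_neg]
        simp)
      rw [hsymm] at h
      rw [hab, hqpi, ← h]
      simp only [q]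
      ring
    · rw [← hshift a b]
      refine harc (Real.sin_pos_of_pos_of_lt_pi hb (by linarith))
        (Real.sin_pos_of_pos_of_lt_pi ha (by linarith))
        (Real.sin_pos_of_pos_of_lt_pi (add_pos ha hb) hab) ?_
      rw [hc, hc, hc, Real.sin_add, Real.cos_add, Real.cos_zero, Real.sin_zero]
      match_scalars
      · linear_combination Real.sin b * Real.sin_sq_add_cos_sq a
      · ring
  have hq : ∀ s ∈ Icc 0 Real.pi, q s = 2 * s / Real.pi := by
    intro s hs
    have h := eq_zero_of_additive_of_bounded (d := fun s => q s - 2 * s / Real.pi) (B := 4)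
      (fun a b ha hb hab => by rw [hqadd a b ha hb hab]; ring)
      (by rw [hqpi]; field_simp; ring) (fun a ha => ?_) s hs
    · linarith
    · have h1 := abs_le.1 (habs (c 0) (c a))
      have h2 : 2 * a / Real.pi ≤ 2 := by
        rw [div_le_iff₀ Real.pi_pos]
        linarith [ha.2]
      have h3 : 0 ≤ 2 * a / Real.pi := div_nonneg (by linarith [ha.1]) Real.pi_pos.le
      simp only [q]
      rw [abs_le]
      constructor <;> linarith
  have hxy := dot_mem_Icc x y
  have hR' : R x y = R (c 0) (c (Real.arccos (dot x y))) := by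
    refine hinv ?_
    rw [hdot, sub_zero, Real.cos_arccos hxy.1 hxy.2]
  have h := hq (Real.arccos (dot x y)) ⟨Real.arccos_nonneg _, Real.arccos_le_pi _⟩
  simp only [q] at h
  rw [hR', KGW, Real.arcsin_eq_pi_div_two_sub_arccos]
  have hpi := Real.pi_ne_zero
  field_simp at h ⊢
  linarith

/-! ### Kernels in the cut polytope bound the integrality gap -/

theorem sdpObjective_le_sdp {V : Type} [Fintype V] (hn : 1 ≤ n) (A : Matrix V V ℝ)
    (f : V → Sphere n) : sdpObjective n A f ≤ sdp n A := by
  obtain ⟨g, hg, h⟩ := exists_isMaxOn_sdpObjective hn A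
  exact h ▸ hg.2 ⟨f, rfl⟩

theorem sdp_nonneg {V : Type} [Fintype V] (hn : 1 ≤ n) {A : Matrix V V ℝ}
    (hA : ∀ x y, 0 ≤ A x y) : 0 ≤ sdp n A := by
  obtain ⟨f, -, h⟩ := exists_isMaxOn_sdpObjective hn A
  rw [h]
  exact Finset.sum_nonneg fun x _ => Finset.sum_nonneg fun y _ =>
    mul_nonneg (hA x y) (by linarith [(dot_mem_Icc (f x) (f y)).2])

theorem dot_sphere_one (x y : Sphere 1) :
    dot x y = (x : EuclideanSpace ℝ (Fin 1)) 0 * (y : EuclideanSpace ℝ (Fin 1)) 0 := by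
  simp [dot, PiLp.inner_apply, mul_comm]

theorem sphere_one_eq_or (x : Sphere 1) :
    (x : EuclideanSpace ℝ (Fin 1)) 0 = 1 ∨ (x : EuclideanSpace ℝ (Fin 1)) 0 = -1 := by
  have h := dot_self x
  rw [dot_sphere_one] at h
  exact mul_self_eq_one_iff.1 h

/-- The value `sdp 1 A` is at least the objective at every `±1`-valued function. -/
theorem sum_le_sdp_one {V : Type} [Fintype V] (A : Matrix V V ℝ) {s : V → ℝ}
    (hs : ∀ x, s x = 1 ∨ s x = -1) : ∑ x, ∑ y, A x y * (1 - s x * s y) ≤ sdp 1 A := by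
  have hnorm : ∀ x, ‖EuclideanSpace.single (0 : Fin 1) (s x)‖ = 1 := by
    intro x
    rcases hs x with h | h <;> simp [h]
  have h := sdpObjective_le_sdp le_rfl A
    (fun x => (⟨EuclideanSpace.single 0 (s x), by simpa using hnorm x⟩ : Sphere 1))
  simpa [sdpObjective, dot_sphere_one] using h

/-- Restricting `K` to the points of an optimal configuration gives a convex combination of cut
matrices, so some cut does at least as well as `K`. -/
theorem mul_sdp_le_of_mem_cutPolytopeSphere {V : Type} [Fintype V] [Nonempty V] (hn : 1 ≤ n)
    {K : Sphere n → Sphere n → ℝ} (hK : K ∈ cutPolytopeSphere n) {α : ℝ}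
    (h : ∀ x y, α * (1 - dot x y) ≤ 1 - K x y) {A : Matrix V V ℝ} (hA : ∀ x y, 0 ≤ A x y) :
    α * sdp n A ≤ sdp 1 A := by
  classical
  obtain ⟨f, -, hf⟩ := exists_isMaxOn_sdpObjective hn A
  let U : Finset (Sphere n) := Finset.univ.image f
  let f' : V → U := fun x => ⟨f x, Finset.mem_image_of_mem f (Finset.mem_univ x)⟩
  let l : Matrix U U ℝ →ₗ[ℝ] ℝ :=
    ∑ x, ∑ y, (-A x y) • Matrix.entryLinearMap ℝ ℝ (f' x) (f' y)
  have hM : l (Matrix.of fun x y : U => K x y) ≤ sdp 1 A - ∑ x, ∑ y, A x y := by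
    refine le_of_mem_cutPolytope (hK.2 U (Finset.univ_nonempty.image f)) fun s hs => ?_
    have h1 := sum_le_sdp_one A (s := fun x => s (f' x)) fun x => hs _
    simp only [l, LinearMap.sum_apply, LinearMap.smul_apply, Matrix.entryLinearMap_apply,
      Matrix.vecMulVec_apply, smul_eq_mul, neg_mul, Finset.sum_neg_distrib]
    simp only [mul_sub, mul_one, Finset.sum_sub_distrib] at h1
    linarith
  simp only [l, LinearMap.sum_apply, LinearMap.smul_apply, Matrix.entryLinearMap_apply,
    Matrix.of_apply, smul_eq_mul, neg_mul, Finset.sum_neg_distrib, f'] at hM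
  have h2 : α * sdp n A ≤ ∑ x, ∑ y, A x y * (1 - K (f x) (f y)) := by
    rw [hf, sdpObjective, Finset.mul_sum]
    refine Finset.sum_le_sum fun x _ => ?_
    rw [Finset.mul_sum]
    refine Finset.sum_le_sum fun y _ => ?_
    rw [mul_left_comm]
    exact mul_le_mul_of_nonneg_left (h _ _) (hA x y)
  simp only [mul_sub, mul_one, Finset.sum_sub_distrib] at h2
  linarith

/-- The inequality `α * sdp n A ≤ sdp 1 A` for all nonnegative matrices `A`. -/
def IsGapBound (n : ℕ) (α : ℝ) : Prop :=
  ∀ (m : ℕ) (A : Matrix (Fin (m + 1)) (Fin (m + 1)) ℝ), (∀ x y, 0 ≤ A x y) →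
    α * sdp n A ≤ sdp 1 A

theorem IsGapBound.mem_upperBounds {α : ℝ} (hα : 0 < α) (h : IsGapBound n α) :
    α⁻¹ ∈ upperBounds (gapRatios n) := by
  rintro r ⟨m, A, hA, h0, rfl⟩
  have hpos : 0 < sdp 1 A := lt_of_le_of_ne (sdp_nonneg le_rfl hA) (Ne.symm h0)
  rw [div_le_iff₀ hpos, inv_mul_eq_div, le_div_iff₀ hα, mul_comm]
  exact h m A hA

theorem exists_pos_mem_gapRatios (hn : 1 ≤ n) : ∃ r ∈ gapRatios n, 0 < r := by
  have hpos : ∀ {k : ℕ}, 1 ≤ k → 0 < sdp k (fun _ _ : Fin 2 => (1 : ℝ)) := by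
    intro k hk
    let x : Sphere k := ⟨EuclideanSpace.single (⟨0, hk⟩ : Fin k) (1 : ℝ), by simp⟩
    refine lt_of_lt_of_le ?_ (sdpObjective_le_sdp hk (fun _ _ : Fin 2 => (1 : ℝ)) ![x, -x])
    have h1 : dot x (-x) = -1 := by simp [dot, x]
    have h2 : dot (-x) x = -1 := by simp [dot, x]
    simp [sdpObjective, Fin.sum_univ_two, h1, h2]
  exact ⟨_, ⟨1, fun _ _ => 1, fun _ _ => zero_le_one, (hpos le_rfl).ne', rfl⟩,
    div_pos (hpos hn) (hpos le_rfl)⟩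

theorem IsGapBound.gammaGap_pos {α : ℝ} (hn : 1 ≤ n) (hα : 0 < α) (h : IsGapBound n α) :
    0 < gammaGap n := by
  obtain ⟨r, hr, hr0⟩ := exists_pos_mem_gapRatios hn
  exact hr0.trans_le (le_csSup ⟨_, h.mem_upperBounds hα⟩ hr)

theorem IsGapBound.le_alphaGap {α : ℝ} (hn : 1 ≤ n) (hα : 0 < α) (h : IsGapBound n α) :
    α ≤ alphaGap n := by
  obtain ⟨r, hr, -⟩ := exists_pos_mem_gapRatios hn
  exact (le_inv_comm₀ (h.gammaGap_pos hn hα) hα).1 (csSup_le ⟨r, hr⟩ (h.mem_upperBounds hα))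

/-- The bound that defines `gammaGap`, extended to the matrices with `sdp 1 A = 0`. -/
theorem IsGapBound.sdp_le {α : ℝ} (hα : 0 < α) (h : IsGapBound n α) {m : ℕ}
    {A : Matrix (Fin (m + 1)) (Fin (m + 1)) ℝ} (hA : ∀ x y, 0 ≤ A x y) :
    sdp n A ≤ gammaGap n * sdp 1 A := by
  rcases (sdp_nonneg le_rfl hA).eq_or_lt with h0 | h0
  · have h1 := h m A hA
    rw [← h0] at h1 ⊢
    rw [mul_zero]
    exact nonpos_of_mul_nonpos_right h1 hα
  · rw [← div_le_iff₀ h0]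
    exact le_csSup ⟨_, h.mem_upperBounds hα⟩ ⟨m, A, hA, h0.ne', rfl⟩

/-! ### Discretizing the pairs of points at a given distance -/

/-- For a finite measurable partition `c` of the sphere, the joint distribution of the cells of
`T x` and `T y`, for a Haar-random `T`. -/
noncomputable def cellMatrix {m : ℕ} (c : Sphere n → Fin (m + 1)) (x y : Sphere n) :
    Matrix (Fin (m + 1)) (Fin (m + 1)) ℝ :=
  fun u v => ((haarO n).map fun T => (c (act T x), c (act T y))).real {(u, v)}

theorem sum_cellMatrix_mul {m : ℕ} {c : Sphere n → Fin (m + 1)} (hc : Measurable c)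
    (x y : Sphere n) (g : Fin (m + 1) → Fin (m + 1) → ℝ) :
    ∑ u, ∑ v, cellMatrix c x y u v * g u v =
      ∫ T, g (c (act T x)) (c (act T y)) ∂(haarO n) := by
  have hm : Measurable fun T : O n => (c (act T x), c (act T y)) :=
    (hc.comp (measurable_act_left x)).prodMk (hc.comp (measurable_act_left y))
  have := Measure.isProbabilityMeasure_map (μ := haarO n) hm.aemeasurable
  have h := integral_map (μ := haarO n) hm.aemeasurable
    (f := fun p : Fin (m + 1) × Fin (m + 1) => g p.1 p.2)
    (Measurable.of_discrete.aestronglyMeasurable)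
  rw [← h, integral_fintype .of_finite, Fintype.sum_prod_type]
  rfl

/-- A cut of the cells induces a cut of the sphere, so a bound for all cuts of the sphere is one for
`sdp 1`. -/
theorem sdp_one_cellMatrix_le {m : ℕ} {c : Sphere n → Fin (m + 1)} (hc : Measurable c)
    {x y : Sphere n} {b : ℝ} (h : ∀ f, IsCut f → 1 - reynolds (tensorSelf f) x y ≤ b) :
    sdp 1 (cellMatrix c x y) ≤ b := by
  obtain ⟨s, -, hs⟩ := exists_isMaxOn_sdpObjective le_rfl (cellMatrix c x y)
  let f : Sphere n → ℝ := fun z => (s (c z) : EuclideanSpace ℝ (Fin 1)) 0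
  have hf : IsCut f := ⟨(Measurable.of_discrete (f := fun u =>
    (s u : EuclideanSpace ℝ (Fin 1)) 0)).comp hc, fun z => sphere_one_eq_or _⟩
  refine le_trans (le_of_eq ?_) (h f hf)
  rw [hs, sdpObjective, sum_cellMatrix_mul hc x y fun u v => 1 - dot (s u) (s v)]
  simp only [dot_sphere_one]
  rw [integral_sub (integrable_const _) (hf.integrable_mul x y)]
  simp [reynolds, tensorSelf, f]

/-- If no cut of the sphere separates the pairs at inner product `x · y` with probability larger
than `β (1 - x · y) / 2`, then the matrices of ever finer partitions show that `α_n ≤ β`. -/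
theorem alphaGap_le_of_forall_isCut (hn : 1 ≤ n) {α : ℝ} (hα : 0 < α) (hb : IsGapBound n α)
    {x y : Sphere n} (hxy : dot x y < 1) {β : ℝ}
    (h : ∀ f, IsCut f → 1 - reynolds (tensorSelf f) x y ≤ β * (1 - dot x y)) :
    alphaGap n ≤ β := by
  have hne : Nonempty (Sphere n) := ⟨x⟩
  let e : ℕ → Sphere n := TopologicalSpace.denseSeq (Sphere n)
  have hγ := hb.gammaGap_pos hn hα
  have hstep : ∀ N, ∫ T, (1 - dot (SimpleFunc.nearestPt e N (act T x))
      (SimpleFunc.nearestPt e N (act T y))) ∂(haarO n) ≤ gammaGap n * (β * (1 - dot x y)) := by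
    intro N
    let c : Sphere n → Fin (N + 1) := fun z =>
      ⟨SimpleFunc.nearestPtInd e N z, Nat.lt_succ_of_le (SimpleFunc.nearestPtInd_le e N z)⟩
    have hc : Measurable c := by
      refine measurable_to_countable' fun u => ?_
      have : c ⁻¹' {u} = SimpleFunc.nearestPtInd e N ⁻¹' {(u : ℕ)} := by
        ext z
        simp [c, Fin.ext_iff]
      rw [this]
      exact SimpleFunc.measurableSet_fiber _ _
    have hA : ∀ u v, 0 ≤ cellMatrix c x y u v := fun u v => measureReal_nonneg
    have h1 := sdpObjective_le_sdp hn (cellMatrix c x y) fun u => e u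
    rw [sdpObjective, sum_cellMatrix_mul hc x y fun u v => 1 - dot (e u) (e v)] at h1
    exact h1.trans ((hb.sdp_le hα hA).trans
      (mul_le_mul_of_nonneg_left (sdp_one_cellMatrix_le hc h) hγ.le))
  have hlim : Filter.Tendsto (fun N => ∫ T, (1 - dot (SimpleFunc.nearestPt e N (act T x))
      (SimpleFunc.nearestPt e N (act T y))) ∂(haarO n)) Filter.atTop
      (nhds (∫ T, (1 - dot (act T x) (act T y)) ∂(haarO n))) := by
    refine tendsto_integral_of_dominated_convergence (fun _ => 2) (fun N => ?_)
      (integrable_const _) (fun N => .of_forall fun T => ?_) (.of_forall fun T => ?_)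
    · have hm : ∀ z, Measurable fun T : O n => SimpleFunc.nearestPt e N (act T z) :=
        fun z => (SimpleFunc.measurable _).comp (measurable_act_left z)
      exact (measurable_const.sub
        (continuous_dot.measurable.comp ((hm x).prodMk (hm y)))).aestronglyMeasurable
    · have := dot_mem_Icc (SimpleFunc.nearestPt e N (act T x)) (SimpleFunc.nearestPt e N (act T y))
      rw [Real.norm_eq_abs, abs_le]
      constructor <;> linarith [this.1, this.2]
    · have hz : ∀ z, Filter.Tendsto (fun N => SimpleFunc.nearestPt e N z) Filter.atTop (nhds z) :=
        fun z => SimpleFunc.tendsto_nearestPt (TopologicalSpace.denseRange_denseSeq _ z)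
      have hd := (continuous_dot.tendsto (act T x, act T y)).comp
        ((hz (act T x)).prodMk_nhds (hz (act T y)))
      exact tendsto_const_nhds.sub hd
  simp only [dot_act, integral_const, probReal_univ, one_smul] at hlim
  have hfin := le_of_tendsto' hlim hstep
  have h1 : 1 ≤ gammaGap n * β := by
    refine le_of_mul_le_mul_right ?_ (sub_pos.2 hxy)
    linarith
  rw [alphaGap, inv_le_iff_one_le_mul₀' hγ]
  exact h1

/-! ### The Goemans–Williamson constant and its minimizer -/

theorem alphaGW_le_gwRatio {t : ℝ} (ht : t ∈ Ico (-1 : ℝ) 1) : alphaGW ≤ gwRatio t := by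
  obtain ⟨s, -, hs, h⟩ := exists_gwRatio_eq_alphaGW
  exact h ▸ hs.2 ⟨t, ht, rfl⟩

theorem alphaGW_mul_le {t : ℝ} (ht : t ∈ Icc (-1 : ℝ) 1) :
    alphaGW * (1 - t) ≤ 1 - KGW t := by
  rcases ht.2.eq_or_lt with rfl | h
  · simp [KGW]
  · exact (le_div_iff₀ (sub_pos.2 h)).1 (alphaGW_le_gwRatio ⟨ht.1, h⟩)

theorem alphaGW_pos : 0 < alphaGW := by
  obtain ⟨t, ht, -, h⟩ := exists_gwRatio_eq_alphaGW
  rw [← h]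
  refine div_pos ?_ (sub_pos.2 ht.2)
  have h1 := Real.arcsin_lt_pi_div_two.2 ht.2
  have hpi := Real.pi_pos
  rw [KGW, sub_pos, div_mul_eq_mul_div, div_lt_one hpi]
  linarith

theorem alphaGW_lt_one : alphaGW < 1 := by
  refine (alphaGW_le_gwRatio (t := -(1 / 2)) (by constructor <;> norm_num)).trans_lt ?_
  have h : Real.arcsin (-(1 / 2)) = -(Real.pi / 6) := by
    have hpi := Real.pi_pos
    rw [Real.arcsin_neg, ← Real.sin_pi_div_six, Real.arcsin_sin (by linarith) (by linarith)]
  have hpi := Real.pi_ne_zero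
  rw [gwRatio, KGW, h]
  field_simp
  norm_num

theorem KGW_le_self {t : ℝ} (ht : t ∈ Icc (0 : ℝ) 1) : KGW t ≤ t := by
  have h := Real.mul_le_sin (Real.arcsin_nonneg.2 ht.1) (Real.arcsin_le_pi_div_two t)
  rwa [Real.sin_arcsin (by linarith [ht.1]) ht.2] at h

/-- Strict midpoint concavity of `arcsin` on `[-1, 0]`, the inverse of a strictly convex
increasing function. -/
theorem arcsin_midpoint_lt {s t : ℝ} (hs : s ∈ Icc (-1 : ℝ) 0) (ht : t ∈ Icc (-1 : ℝ) 0)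
    (hst : s ≠ t) : (Real.arcsin s + Real.arcsin t) / 2 < Real.arcsin ((s + t) / 2) := by
  have hpi := Real.pi_pos
  have hs1 := Real.neg_pi_div_two_le_arcsin s
  have ht1 := Real.neg_pi_div_two_le_arcsin t
  have hs0 := Real.arcsin_nonpos.2 hs.2
  have ht0 := Real.arcsin_nonpos.2 ht.2
  have hne : -Real.arcsin s ≠ -Real.arcsin t := fun h =>
    hst (Real.injOn_arcsin ⟨hs.1, by linarith [hs.2]⟩ ⟨ht.1, by linarith [ht.2]⟩ (neg_injective h))
  have h := strictConcaveOn_sin_Icc.2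
    (show -Real.arcsin s ∈ Icc 0 Real.pi from ⟨by linarith, by linarith⟩)
    (show -Real.arcsin t ∈ Icc 0 Real.pi from ⟨by linarith, by linarith⟩) hne
    one_half_pos one_half_pos (add_halves 1)
  simp only [smul_eq_mul, Real.sin_neg] at h
  rw [Real.sin_arcsin hs.1 (by linarith [hs.2]), Real.sin_arcsin ht.1 (by linarith [ht.2]),
    show 1 / 2 * -Real.arcsin s + 1 / 2 * -Real.arcsin t =
      -((Real.arcsin s + Real.arcsin t) / 2) by ring, Real.sin_neg] at h
  rw [Real.lt_arcsin_iff_sin_lt ⟨by linarith, by linarith⟩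
    ⟨by linarith [hs.1, ht.1], by linarith [hs.2, ht.2]⟩]
  linarith

/-- The minimizer of `gwRatio` is unique: `1 - KGW t - alphaGW * (1 - t)` is nonnegative, strictly
convex on `[-1, 0]` and positive on `(0, 1)`. -/
theorem eq_of_gwRatio_eq_alphaGW {s t : ℝ} (hs : s ∈ Ico (-1 : ℝ) 1) (ht : t ∈ Ico (-1 : ℝ) 1)
    (hs' : gwRatio s = alphaGW) (ht' : gwRatio t = alphaGW) : s = t := by
  have hneg : ∀ {r : ℝ}, r ∈ Ico (-1 : ℝ) 1 → gwRatio r = alphaGW → r ∈ Icc (-1 : ℝ) 0 := by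
    intro r hr h
    refine ⟨hr.1, ?_⟩
    by_contra! h0
    have h1 := KGW_le_self ⟨h0.le, hr.2.le⟩
    have h2 := alphaGW_lt_one
    rw [← h, gwRatio, div_lt_one (sub_pos.2 hr.2)] at h2
    linarith
  by_contra hst
  have hmid := arcsin_midpoint_lt (hneg hs hs') (hneg ht ht') hst
  have hle := alphaGW_mul_le (t := (s + t) / 2)
    ⟨by linarith [hs.1, ht.1], by linarith [hs.2, ht.2]⟩
  rw [gwRatio, div_eq_iff (sub_pos.2 hs.2).ne'] at hs'
  rw [gwRatio, div_eq_iff (sub_pos.2 ht.2).ne'] at ht'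
  have hmul := mul_lt_mul_of_pos_left hmid (div_pos two_pos Real.pi_pos)
  unfold KGW at hs' ht' hle
  linarith

theorem KGW_dot_mem_cutPolytopeSphere (hn : 2 ≤ n) :
    (fun x y : Sphere n => KGW (dot x y)) ∈ cutPolytopeSphere n := by
  have h : (fun x y : Sphere n => KGW (dot x y)) = reynolds (tensorSelf lexSign) :=
    funext fun x => funext fun y => (reynolds_lexSign hn x y).symm
  exact h ▸ isCut_lexSign.reynolds_mem

theorem isGapBound_alphaGW (hn : 2 ≤ n) : IsGapBound n alphaGW := fun _ _ hA =>
  mul_sdp_le_of_mem_cutPolytopeSphere (by omega) (KGW_dot_mem_cutPolytopeSphere hn)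
    (fun x y => alphaGW_mul_le (dot_mem_Icc x y)) hA

/-! ### Perturbing the Goemans–Williamson kernel -/

theorem convex_cutPolytopeSphere : Convex ℝ (cutPolytopeSphere n) := by
  intro K hK L hL a b ha hb hab
  exact ⟨(hK.1.const_smul a).add (hL.1.const_smul b), fun U hU =>
    convex_convexHull ℝ _ (hK.2 U hU) (hL.2 U hU) ha hb hab⟩

/-- If `h` is nonnegative on a compact set and `g` is positive wherever `h` vanishes, then a small
multiple of `g` can be added to `h` to obtain a function with a positive lower bound. -/
theorem exists_forall_le_add_of_isCompact {X : Type*} [TopologicalSpace X] {C : Set X}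
    (hC : IsCompact C) {g h : X → ℝ} (hg : Continuous g) (hh : Continuous h)
    (h0 : ∀ x ∈ C, 0 ≤ h x) (hgh : ∀ x ∈ C, h x = 0 → 0 < g x) {ε : ℝ} (hε : 0 < ε) :
    ∃ l ∈ Ioc 0 ε, ∃ δ > 0, ∀ x ∈ C, δ ≤ l * g x + (1 - l) * h x := by
  -- On the part of `C` where `g ≤ 0`, `h` is at least some `η > 0`; on `C`, `g` is at least `M`.
  obtain ⟨η, hη, hηh⟩ : ∃ η > 0, ∀ x ∈ C ∩ {x | g x ≤ 0}, η ≤ h x := by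
    refine (hC.inter_right (isClosed_le hg continuous_const)).exists_forall_le'
      hh.continuousOn fun x hx => ?_
    exact lt_of_le_of_ne (h0 x hx.1) fun h => (hgh x hx.1 h.symm).not_ge hx.2
  obtain ⟨M, hM⟩ := hC.bddBelow_image hg.continuousOn
  have hM' : ∀ x ∈ C, M ≤ g x := fun x hx => hM ⟨x, hx, rfl⟩
  let l := min (min ε (1 / 2)) (η / (4 * (|M| + 1)))
  have hden : 0 < 4 * (|M| + 1) := by positivity
  have hl : 0 < l := lt_min (lt_min hε (by norm_num)) (div_pos hη hden)
  have hl1 : l ≤ 1 / 2 := (min_le_left _ _).trans (min_le_right _ _)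
  have hl2 : l * (4 * (|M| + 1)) ≤ η := (le_div_iff₀ hden).1 (min_le_right _ _)
  have hpos : ∀ x ∈ C, 0 < l * g x + (1 - l) * h x := by
    intro x hx
    rcases le_or_gt (g x) 0 with hgx | hgx
    · have h1 := hηh x ⟨hx, hgx⟩
      have h2 : l * -|M| ≤ l * g x :=
        mul_le_mul_of_nonneg_left ((neg_abs_le M).trans (hM' x hx)) hl.le
      have h3 : (1 / 2) * η ≤ (1 - l) * h x :=
        mul_le_mul (by linarith) h1 hη.le (by linarith)
      linarith
    · exact add_pos_of_pos_of_nonneg (mul_pos hl hgx) (mul_nonneg (by linarith) (h0 x hx))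
  obtain ⟨δ, hδ, hδC⟩ := hC.exists_forall_le' (f := fun x => l * g x + (1 - l) * h x)
    (by fun_prop) hpos
  exact ⟨l, ⟨hl, (min_le_left _ _).trans (min_le_left _ _)⟩, δ, hδ, hδC⟩

/-- A kernel that beats the Goemans–Williamson kernel at `t` improves the integrality gap: a convex
combination of the two beats the ratio `alphaGW` at every pair of points, as the second one does so
except at inner product `t`. -/
theorem alphaGW_lt_alphaGap_of_lt (hn : 2 ≤ n) {t : ℝ} (ht : t ∈ Ico (-1 : ℝ) 1)
    (hmin : gwRatio t = alphaGW) {K : Sphere n → Sphere n → ℝ} (hK : K ∈ cutPolytopeSphere n)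
    (hlt : ∀ x y, dot x y = t → K x y < KGW t) : alphaGW < alphaGap n := by
  have hα := alphaGW_pos
  have hα1 := alphaGW_lt_one
  have hC : IsCompact {p : Sphere n × Sphere n | dot p.1 p.2 ≤ 0} :=
    (isClosed_le continuous_dot continuous_const).isCompact
  have hzero : ∀ {s : ℝ}, s ∈ Ico (-1 : ℝ) 1 → 1 - KGW s - alphaGW * (1 - s) = 0 → s = t := by
    intro s hs h
    refine eq_of_gwRatio_eq_alphaGW hs ht ?_ hmin
    rw [gwRatio, div_eq_iff (sub_pos.2 hs.2).ne']
    linarith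
  have hcK := (KGW_dot_mem_cutPolytopeSphere hn).1
  obtain ⟨l, ⟨hl, hlα⟩, δ, hδ, hlδ⟩ := exists_forall_le_add_of_isCompact hC
    (g := fun p => 1 - K p.1 p.2 - alphaGW * (1 - dot p.1 p.2))
    (h := fun p => 1 - KGW (dot p.1 p.2) - alphaGW * (1 - dot p.1 p.2))
    ((continuous_const.sub hK.1).sub (continuous_const.mul (continuous_const.sub continuous_dot)))
    ((continuous_const.sub hcK).sub (continuous_const.mul (continuous_const.sub continuous_dot)))
    (fun p _ => sub_nonneg.2 (alphaGW_mul_le (dot_mem_Icc p.1 p.2)))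
    (fun p hp h => by
      have hp1 : dot p.1 p.2 < 1 := lt_of_le_of_lt hp one_pos
      have hpt := hzero ⟨(dot_mem_Icc p.1 p.2).1, hp1⟩ h
      have := hlt p.1 p.2 hpt
      rw [← hpt] at this
      linarith)
    (ε := (1 - alphaGW) / 2) (by linarith)
  let β := alphaGW + min (δ / 2) ((1 - alphaGW) / 2)
  have hβ : alphaGW < β := lt_add_of_pos_right _ (lt_min (by linarith) (by linarith))
  have hβ1 : β ≤ alphaGW + δ / 2 := by simp [β]
  have hβ2 : β ≤ 1 - l := by
    have : β ≤ alphaGW + (1 - alphaGW) / 2 := by simp [β]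
    linarith
  have hl1 : 0 ≤ 1 - l := by linarith
  have hL := convex_cutPolytopeSphere hK (KGW_dot_mem_cutPolytopeSphere hn) hl.le hl1 (by ring)
  refine hβ.trans_le (IsGapBound.le_alphaGap (by omega) (by linarith) fun m A hA =>
    mul_sdp_le_of_mem_cutPolytopeSphere (by omega) hL (fun x y => ?_) hA)
  simp only [Pi.add_apply, Pi.smul_apply, smul_eq_mul]
  have hd := dot_mem_Icc x y
  rcases le_or_gt (dot x y) 0 with hxy | hxy
  · have h1 := hlδ (x, y) hxy
    simp only at h1
    have h2 : β * (1 - dot x y) ≤ (alphaGW + δ / 2) * (1 - dot x y) :=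
      mul_le_mul_of_nonneg_right hβ1 (by linarith)
    have h3 : δ / 2 * (1 - dot x y) ≤ δ / 2 * 2 :=
      mul_le_mul_of_nonneg_left (by linarith [hd.1]) (by linarith)
    linarith
  -- For `x · y > 0` the Goemans–Williamson kernel alone has ratio at least `1 > alphaGW`.
  · have h1 : β * (1 - dot x y) ≤ (1 - l) * (1 - dot x y) :=
      mul_le_mul_of_nonneg_right hβ2 (by linarith [hd.2])
    have h2 : (1 - l) * (1 - dot x y) ≤ (1 - l) * (1 - KGW (dot x y)) :=
      mul_le_mul_of_nonneg_left (by linarith [KGW_le_self ⟨hxy.le, hd.2⟩]) hl1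
    have h3 : l * K x y ≤ l * 1 :=
      mul_le_mul_of_nonneg_left (le_one_of_mem_cutPolytopeSphere hK x y) hl.le
    linarith

end MaxCut

open MaxCut in
theorem theorem2 (n : ℕ) (hn : 2 ≤ n) (tGW : ℝ) (htGW : tGW ∈ Set.Ico (-1 : ℝ) 1)
    (hmin : gwRatio tGW = alphaGW) :
    (alphaGap n > alphaGW ↔
      ∃ K ∈ cutPolytopeSphere n, IsInvariant K ∧
        1 - valueAt K tGW > 1 - 2 / Real.pi * Real.arcsin tGW) ∧
    (alphaGap n > alphaGW →
      ∃ f : Sphere n → ℝ, Measurable f ∧ (∀ x, f x = 1 ∨ f x = -1) ∧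
        reynolds (tensorSelf f) ∈ cutPolytopeSphere n ∧
        IsInvariant (reynolds (tensorSelf f)) ∧
        1 - valueAt (reynolds (tensorSelf f)) tGW >
          1 - 2 / Real.pi * Real.arcsin tGW) := by
  obtain ⟨x, y, hxy⟩ := exists_dot_eq hn (Set.Ico_subset_Icc_self htGW)
  have hcut : alphaGap n > alphaGW →
      ∃ f : Sphere n → ℝ, Measurable f ∧ (∀ x, f x = 1 ∨ f x = -1) ∧
        reynolds (tensorSelf f) ∈ cutPolytopeSphere n ∧
        IsInvariant (reynolds (tensorSelf f)) ∧
        1 - valueAt (reynolds (tensorSelf f)) tGW >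
          1 - 2 / Real.pi * Real.arcsin tGW := by
    intro hgap
    by_contra! hno
    refine hgap.not_ge (alphaGap_le_of_forall_isCut (by omega) alphaGW_pos (isGapBound_alphaGW hn)
      (x := x) (y := y) (hxy ▸ htGW.2) fun f hf => ?_)
    have h := hno f hf.measurable hf.eq_or_eq hf.reynolds_mem (isInvariant_reynolds _)
    rw [← hxy, valueAt_dot (isInvariant_reynolds _), hxy] at h
    rw [gwRatio, div_eq_iff (sub_pos.2 htGW.2).ne'] at hmin
    rw [hxy, ← hmin]
    exact h
  refine ⟨⟨fun hgap => ?_, ?_⟩, hcut⟩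
  · obtain ⟨f, -, -, hmem, hinv, hlt⟩ := hcut hgap
    exact ⟨_, hmem, hinv, hlt⟩
  · rintro ⟨K, hK, hinv, hlt⟩
    refine alphaGW_lt_alphaGap_of_lt hn htGW hmin hK fun u v huv => ?_
    rw [← valueAt_dot hinv, huv, KGW]
    linarith
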